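/- For $f\in L^2(\mathbb R)$ (complex valued) let $\widehat f(\xi)=\frac1{\sqrt{2\pi}}\int_{\mathbb R}e^{-ix\xi}f(x)\,dx$ denote the (Plancherel) Fourier transform. For $\sigma\in\mathbb R$ define $D^{\sigma}f$ by $(D^{\sigma}f)^{\wedge}(\xi)=|\xi|^{\sigma}\widehat f(\xi)$, and for $s\ge 0$, $r\in\mathbb R$ let $$Z_{s,r}:=\{f\in H^s(\mathbb R): D^{-s}f\in L^2(\mathbb R)\}\cap L^2(|x|^{2r}\,dx).$$ Let $\{U_\pm(t)\}_{t\in\mathbb R}$ be the unitary groups on $L^2(\mathbb R)$ associated with the linear Ostrovsky equations $u_t+\partial_x^3u\pm\partial_x^{-1}u=0$, where $(\partial_x^{-1}u)^{\wedge}(\xi)=\widehat u(\xi)/(i\xi)$, that is, $$[U_\pm(t)f](x)=\frac1{\sqrt{2\pi}}\int_{\mathbb R}e^{i[t(\xi^3\pm\frac1\xi)+x\xi]}\,\widehat f(\xi)\,d\xi$$ (understood as the inverse Fourier transform on $L^2(\mathbb R)$). **Lemma 2.4.** For every $b\in(0,1/2]$ there exists a constant $C_b>0$, depending only on $b$, such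 that for both choices of sign, all $t\ge0$ and all $f\in Z_{2b,b}$, the function $|x|^bU_\pm(t)f$ belongs to $L^2(\mathbb R)$ and $$\||x|^bU_\pm(t)f\|_{L^2}\le C_b\Big[\big(1+t^{\frac b3}+t^{\frac13+\frac{2b}9}\big)\|f\|_{L^2}+\big(t^{\frac13+\frac{2b}3}+t^{\frac{2b}3}\big)\|D^{2b}f\|_{L^2}+t^b\|D^{-2b}f\|_{L^2}+\||x|^bf\|_{L^2}\Big].$$ -/

import Mathlib

open MeasureTheory FourierTransform

/-- The complex Hilbert space `L²(ℝ)` (Lebesgue measure). -/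
abbrev L2R : Type := Lp ℂ 2 (volume : Measure ℝ)

/-- The function `ξ ↦ m(2πξ) · 𝓕f(ξ)`, where `𝓕` is the Plancherel transform on `L²(ℝ)`
with kernel `e^{-2πixξ}`. In terms of the unitary transform with kernel
`(2π)^{-1/2} e^{-ixη}`, i.e. `f̂(η) = (2π)^{-1/2} 𝓕f(η / 2π)`, this is, up to the rescaling
`η = 2πξ`, the product `m(η) f̂(η)`. -/
noncomputable def symbolMul (m : ℝ → ℂ) (f : L2R) : ℝ → ℂ :=
  fun ξ => m (2 * Real.pi * ξ) * (𝓕 f : L2R) ξ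

/-- The symbol `|η|^σ` of the homogeneous fractional derivative. -/
noncomputable def fracSymbol (σ : ℝ) (η : ℝ) : ℂ := ((|η| ^ σ : ℝ) : ℂ)

/-- `D^σ f ∈ L²(ℝ)`, that is, `|η|^σ f̂(η)` is square integrable. -/
def HasFracDeriv (σ : ℝ) (f : L2R) : Prop := MemLp (symbolMul (fracSymbol σ) f) 2 volume

open Classical in
/-- The homogeneous fractional derivative `D^σ f`, defined by `(D^σ f)^(η) = |η|^σ f̂(η)`.
It is meant for `f` with `HasFracDeriv σ f`, and is set to `0` for every other `f`. -/
noncomputable def fracDeriv (σ : ℝ) (f : L2R) : L2R :=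
  if h : HasFracDeriv σ f then 𝓕⁻ (h.toLp (symbolMul (fracSymbol σ) f)) else 0

/-- The space `Z_{s,r} = {f ∈ H^s(ℝ) : D^{-s} f ∈ L²(ℝ)} ∩ L²(|x|^{2r} dx)`, for `s ≥ 0`
(so that `H^s(ℝ) ⊆ L²(ℝ)`). -/
def ZSpace (s r : ℝ) : Set L2R :=
  {f | TemperedDistribution.MemSobolev s 2 (f : TemperedDistribution ℝ ℂ) ∧
    HasFracDeriv (-s) f ∧
    MemLp (fun x : ℝ => ((|x| ^ r : ℝ) : ℂ) * f x) 2 volume}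

/-- The symbol `e^{it(η³ + ε/η)}` of the linear Ostrovsky group; `ε = 1` and `ε = -1` are the two
choices of sign. -/
noncomputable def ostrovskySymbol (ε t : ℝ) (η : ℝ) : ℂ :=
  Complex.exp (Complex.I * ((t * (η ^ 3 + ε / η) : ℝ) : ℂ))

theorem memLp_ostrovskySymbol_mul (ε t : ℝ) (f : L2R) :
    MemLp (symbolMul (ostrovskySymbol ε t) f) 2 volume := by
  have hm : Measurable fun ξ : ℝ => ostrovskySymbol ε t (2 * Real.pi * ξ) := by
    unfold ostrovskySymbol
    fun_prop
  refine (Lp.memLp (𝓕 f : L2R)).of_le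
    (hm.aestronglyMeasurable.mul (Lp.aestronglyMeasurable (𝓕 f : L2R))) ?_
  refine Filter.Eventually.of_forall fun ξ => ?_
  have h : ‖ostrovskySymbol ε t (2 * Real.pi * ξ)‖ = 1 := by
    unfold ostrovskySymbol
    rw [mul_comm]
    exact Complex.norm_exp_ofReal_mul_I _
  simp [symbolMul, h]

/-- The linear Ostrovsky group `U_±(t)` on `L²(ℝ)` (sign `ε = ±1`): the solution operator of
`u_t + ∂_x³ u ± ∂_x⁻¹ u = 0`, i.e.
`[U_±(t) f](x) = (2π)^{-1/2} ∫ e^{i[t(η³ ± 1/η) + xη]} f̂(η) dη`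
(the integral being the inverse Plancherel transform). -/
noncomputable def ostrovskyGroup (ε t : ℝ) (f : L2R) : L2R :=
  𝓕⁻ ((memLp_ostrovskySymbol_mul ε t f).toLp (symbolMul (ostrovskySymbol ε t) f))

/-! Put `s = 2b ∈ (0,1]` and `F = 𝓕 f`. By Plancherel and homogeneity, `∫ |x|^s |f|²` is a constant
multiple of the Gagliardo integral `∬ |F(ξ-y) - F(ξ)|² |y|^(-1-s) dξ dy`
(`lintegral_gagliardo_fourier`). The group multiplies `F` by a unimodular symbol `m`, so the
increment of `mF` costs the increment of `F`, which returns the weighted norm of `f`, plus `|F(ξ)|²`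
times the increment of `m`.

All then rests on a pointwise bound, at frequency `η ≠ 0`, for `∫ |m(η-y) - m(η)|² |y|^(-1-s) dy` by
a multiple of `t^(s/3) + t^s |η|^(2s) + t^s |η|^(-2s)` (`exists_lintegral_ostrovskySymbol_sub_le`).
The cubic phase behaves like a linear phase of speed `t^(1/3) + tη²`; the phase `t/η` behaves like
one of speed `t/η²`, except near its singularity `y = η`, which is integrated separately.

Integrating against `|F|²` gives the norms of `f`, `D^s f` and `D^(-s) f` with factors `t^(b/3)`,
`t^b`, `t^b`. This is sharper than the claim, since `t^b ≤ t^(1/3+2b/3) + t^(2b/3)`. -/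

/-! ### Translation in frequency as modulation in space. -/

theorem measurePreserving_sub_const (a : ℝ) :
    MeasurePreserving (fun x : ℝ => x - a) volume volume :=
  measurePreserving_sub_right volume a

theorem memLp_top_expFun (a : ℝ) :
    MemLp (fun x : ℝ => Complex.exp (Complex.I * ((2 * Real.pi * (a * x) : ℝ) : ℂ))) ⊤ volume := by
  refine memLp_top_of_bound (by fun_prop) 1 (Filter.Eventually.of_forall fun x => ?_)
  rw [mul_comm, Complex.norm_exp_ofReal_mul_I]

theorem SchwartzMap.fourierInv_compSubConst (G : SchwartzMap ℝ ℂ) (a x : ℝ) :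
    𝓕⁻ (G.compSubConstCLM ℂ a) x =
      Complex.exp (Complex.I * ((2 * Real.pi * (a * x) : ℝ) : ℂ)) * 𝓕⁻ G x := by
  rw [SchwartzMap.fourierInv_coe, SchwartzMap.fourierInv_coe, Real.fourierInv_eq',
    Real.fourierInv_eq', ← integral_const_mul,
    ← integral_add_right_eq_self _ a]
  congr 1
  ext v
  simp only [SchwartzMap.compSubConstCLM_apply, add_sub_cancel_right, smul_eq_mul]
  rw [← mul_assoc, ← Complex.exp_add]
  congr 2
  simp
  ring

/-- Both sides are continuous in `G`, so it suffices to treat Schwartz functions, where a change of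
variable in the integral applies. -/
theorem fourierInv_comp_sub_const (G : L2R) (a : ℝ) :
    𝓕⁻ (Lp.compMeasurePreserving _ (measurePreserving_sub_const a) G) =
      (ContinuousLinearMap.mul ℂ ℂ).holderL volume ⊤ 2 2 ((memLp_top_expFun a).toLp _)
        (𝓕⁻ G : L2R) := by
  refine DenseRange.induction_on
    (p := fun G : L2R => 𝓕⁻ (Lp.compMeasurePreserving _ (measurePreserving_sub_const a) G) =
      (ContinuousLinearMap.mul ℂ ℂ).holderL volume ⊤ 2 2 ((memLp_top_expFun a).toLp _)
        (𝓕⁻ G : L2R))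
    (SchwartzMap.denseRange_toLpCLM (p := 2) ENNReal.ofNat_ne_top) G ?_ ?_
  · apply isClosed_eq
    · exact (Lp.fourierTransformₗᵢ ℝ ℂ).symm.continuous.comp
        (Lp.isometry_compMeasurePreserving (measurePreserving_sub_const a)).continuous
    · exact (ContinuousLinearMap.continuous _).comp (Lp.fourierTransformₗᵢ ℝ ℂ).symm.continuous
  · intro φ
    have h1 : Lp.compMeasurePreserving _ (measurePreserving_sub_const a)
        (SchwartzMap.toLpCLM ℝ ℂ 2 volume φ) = (φ.compSubConstCLM ℂ a).toLp 2 := rfl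
    rw [h1, SchwartzMap.toLp_fourierInv_eq, SchwartzMap.toLpCLM_apply,
      SchwartzMap.toLp_fourierInv_eq]
    apply Lp.ext
    filter_upwards [SchwartzMap.coeFn_toLp (𝓕⁻ (φ.compSubConstCLM ℂ a)) 2 volume,
      SchwartzMap.coeFn_toLp (𝓕⁻ φ) 2 volume, (memLp_top_expFun a).coeFn_toLp,
      (ContinuousLinearMap.mul ℂ ℂ).coeFn_holder (r := 2) ((memLp_top_expFun a).toLp _)
        ((𝓕⁻ φ).toLp 2 volume)] with x h1 h2 h3 h4
    rw [ContinuousLinearMap.holderL_apply_apply, h4, h1, h2, h3,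
      SchwartzMap.fourierInv_compSubConst]
    rfl

theorem sq_enorm_eq_lintegral (f : L2R) : ‖f‖ₑ ^ 2 = ∫⁻ x, ‖f x‖ₑ ^ 2 := by
  rw [Lp.enorm_def, eLpNorm_eq_lintegral_rpow_enorm_toReal (by norm_num) (by norm_num)]
  rw [← ENNReal.rpow_natCast, ← ENNReal.rpow_mul]
  norm_num

/-- Plancherel: the inverse transform carries the difference to `(e^{2πiax} - 1) f(x)`. -/
theorem lintegral_fourier_sub (f : L2R) (a : ℝ) :
    ∫⁻ ξ, ‖(𝓕 f : L2R) (ξ - a) - (𝓕 f : L2R) ξ‖ₑ ^ 2 =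
      ∫⁻ x, ‖Complex.exp (Complex.I * ((2 * Real.pi * (a * x) : ℝ) : ℂ)) - 1‖ₑ ^ 2
        * ‖f x‖ₑ ^ 2 := by
  set T := Lp.compMeasurePreserving (p := 2) _ (measurePreserving_sub_const a) (𝓕 f : L2R)
  have h1 : ‖T - (𝓕 f : L2R)‖ₑ ^ 2 = ∫⁻ ξ, ‖(𝓕 f : L2R) (ξ - a) - (𝓕 f : L2R) ξ‖ₑ ^ 2 := by
    rw [sq_enorm_eq_lintegral]
    refine lintegral_congr_ae ?_
    filter_upwards [Lp.coeFn_sub T (𝓕 f : L2R),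
      Lp.coeFn_compMeasurePreserving (𝓕 f : L2R) (measurePreserving_sub_const a)] with ξ h1 h2
    rw [h1, Pi.sub_apply, h2]
    rfl
  have h2 : ‖T - (𝓕 f : L2R)‖ₑ = ‖(𝓕⁻ T : L2R) - f‖ₑ := by
    have h3 : (𝓕⁻ T : L2R) - f = (Lp.fourierTransformₗᵢ ℝ ℂ).symm (T - 𝓕 f) := by
      rw [map_sub]
      congr 1
      exact ((Lp.fourierTransformₗᵢ ℝ ℂ).symm_apply_apply f).symm
    rw [h3, ← ofReal_norm, ← ofReal_norm, LinearIsometryEquiv.norm_map]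
  rw [← h1, h2, sq_enorm_eq_lintegral]
  have h4 := fourierInv_comp_sub_const (𝓕 f : L2R) a
  rw [show 𝓕⁻ (𝓕 f : L2R) = f from (Lp.fourierTransformₗᵢ ℝ ℂ).symm_apply_apply f] at h4
  refine lintegral_congr_ae ?_
  filter_upwards [Lp.coeFn_sub (𝓕⁻ T : L2R) f, (memLp_top_expFun a).coeFn_toLp,
    (ContinuousLinearMap.mul ℂ ℂ).coeFn_holder (r := 2) ((memLp_top_expFun a).toLp _) f]
    with x h5 h6 h7
  rw [h5, Pi.sub_apply, h4, ContinuousLinearMap.holderL_apply_apply, h7, h6,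
    ContinuousLinearMap.mul_apply', ← mul_pow, ← enorm_mul, sub_mul, one_mul]

/-! ### Homogeneous Gagliardo integrals. -/

/-- The homogeneous weight `|y|^(-1-s)` of the Gagliardo seminorm. -/
noncomputable def gagliardoWeight (s y : ℝ) : ENNReal := ENNReal.ofReal (|y| ^ (-1 - s))

@[fun_prop]
theorem measurable_gagliardoWeight (s : ℝ) : Measurable (gagliardoWeight s) := by
  unfold gagliardoWeight; fun_prop

theorem lintegral_comp_const_mul {h : ℝ → ENNReal} (hh : Measurable h) {a : ℝ} (ha : a ≠ 0) :
    ∫⁻ y, h (a * y) = ENNReal.ofReal |a⁻¹| * ∫⁻ y, h y := by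
  rw [← lintegral_map hh (measurable_const_mul a), Real.map_volume_mul_left ha,
    lintegral_smul_measure, smul_eq_mul]

/-- The weight has degree `-1-s` and `dy` has degree `1`, so dilation by `a` leaves `|a|^s`. Every
power of `x`, `t` and `η` below comes from this scaling. -/
theorem lintegral_comp_const_mul_gagliardoWeight {h : ℝ → ENNReal} (hh : Measurable h) (s : ℝ)
    {a : ℝ} (ha : a ≠ 0) :
    ∫⁻ y, h (a * y) * gagliardoWeight s y =
      ENNReal.ofReal (|a| ^ s) * ∫⁻ y, h y * gagliardoWeight s y := by
  have ha' : 0 < |a| := abs_pos.mpr ha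
  have h1 : ∀ y, h (a * y) * gagliardoWeight s y =
      ENNReal.ofReal (|a| ^ (1 + s)) * (h (a * y) * gagliardoWeight s (a * y)) := by
    intro y
    rw [mul_left_comm]
    congr 1
    rw [gagliardoWeight, gagliardoWeight, ← ENNReal.ofReal_mul (by positivity), abs_mul,
      Real.mul_rpow (by positivity) (by positivity), ← mul_assoc, ← Real.rpow_add ha']
    simp
  simp_rw [h1]
  rw [lintegral_const_mul _ (by fun_prop),
    lintegral_comp_const_mul (h := fun y => h y * gagliardoWeight s y) (by fun_prop) ha,
    ← mul_assoc, ← ENNReal.ofReal_mul (by positivity)]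
  congr 2
  rw [abs_inv, Real.rpow_add ha', Real.rpow_one]
  field_simp

/-- The Gagliardo integral `∫ min(1, y²) |y|^(-1-s) dy`. -/
noncomputable def gagliardoConst (s : ℝ) : ENNReal :=
  ∫⁻ y : ℝ, ENNReal.ofReal (min 1 (y ^ 2)) * gagliardoWeight s y

/-- The integrand is `y^(1-s)` near `0`, integrable for `s < 2`, and `y^(-1-s)` at infinity,
integrable for `s > 0`. -/
theorem gagliardoConst_lt_top {s : ℝ} (hs : 0 < s) (hs' : s < 2) : gagliardoConst s < ⊤ := by
  set F : ℝ → ENNReal := fun y => ENNReal.ofReal (min 1 (y ^ 2)) * gagliardoWeight s y with hF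
  have hneg : ∀ y, F (-y) = F y := by intro y; simp [hF, gagliardoWeight]
  have h1 : ∫⁻ y in Set.Ioc 0 1, F y < ⊤ := by
    have hi : IntegrableOn (fun y : ℝ => y ^ (1 - s)) (Set.Ioc 0 1) volume :=
      (intervalIntegrable_iff_integrableOn_Ioc_of_le zero_le_one).mp
        (intervalIntegral.intervalIntegrable_rpow' (by linarith))
    refine lt_of_le_of_lt (setLIntegral_mono' measurableSet_Ioc fun y hy => ?_) hi.lintegral_lt_top
    change ENNReal.ofReal (min 1 (y ^ 2)) * ENNReal.ofReal (|y| ^ (-1 - s)) ≤ _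
    rw [← ENNReal.ofReal_mul (by positivity), abs_of_pos hy.1]
    apply ENNReal.ofReal_le_ofReal
    calc min 1 (y ^ 2) * y ^ (-1 - s) ≤ y ^ (2 : ℝ) * y ^ (-1 - s) := by
          have := hy.1
          gcongr
          rw [Real.rpow_two]; exact min_le_right _ _
      _ = y ^ (1 - s) := by rw [← Real.rpow_add hy.1]; congr 1; ring
  have h2 : ∫⁻ y in Set.Ioi 1, F y < ⊤ := by
    have hi : IntegrableOn (fun y : ℝ => y ^ (-1 - s)) (Set.Ioi 1) volume :=
      integrableOn_Ioi_rpow_of_lt (by linarith) zero_lt_one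
    refine lt_of_le_of_lt (setLIntegral_mono' measurableSet_Ioi fun y hy => ?_) hi.lintegral_lt_top
    have hy0 : 0 < y := lt_trans zero_lt_one hy
    change ENNReal.ofReal (min 1 (y ^ 2)) * ENNReal.ofReal (|y| ^ (-1 - s)) ≤ _
    rw [← ENNReal.ofReal_mul (by positivity), abs_of_pos hy0]
    apply ENNReal.ofReal_le_ofReal
    exact mul_le_of_le_one_left (by positivity) (min_le_left _ _)
  have h3 : ∫⁻ y in Set.Ioi 0, F y < ⊤ := by
    rw [← Set.Ioc_union_Ioi_eq_Ioi (zero_le_one (α := ℝ))]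
    exact lt_of_le_of_lt (lintegral_union_le _ _ _) (ENNReal.add_lt_top.mpr ⟨h1, h2⟩)
  have h4 : ∫⁻ y in Set.Iio 0, F y = ∫⁻ y in Set.Ioi 0, F y := by
    have h := (Measure.measurePreserving_neg (volume : Measure ℝ)).setLIntegral_comp_preimage
      (s := Set.Ioi (0 : ℝ)) measurableSet_Ioi (f := F) (by fun_prop)
    simpa [hneg] using h
  rw [gagliardoConst, ← lintegral_add_compl _ (measurableSet_Ioi (a := (0 : ℝ))), Set.compl_Ioi,
    setLIntegral_congr Iio_ae_eq_Iic.symm]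
  exact ENNReal.add_lt_top.mpr ⟨h3, h4 ▸ h3⟩

theorem lintegral_min_one_sq_gagliardoWeight {s : ℝ} {a : ℝ} (ha : 0 < a) :
    ∫⁻ y : ℝ, ENNReal.ofReal (min 1 ((a * y) ^ 2)) * gagliardoWeight s y =
      ENNReal.ofReal (a ^ s) * gagliardoConst s := by
  rw [lintegral_comp_const_mul_gagliardoWeight (h := fun y => ENNReal.ofReal (min 1 (y ^ 2)))
    (by fun_prop) s ha.ne', abs_of_pos ha]
  rfl

/-- The constant relating the Gagliardo seminorm on the Fourier side to the weight `|x|^s`. -/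
noncomputable def fourierGagliardoConst (s : ℝ) : ENNReal :=
  ∫⁻ y : ℝ, ‖Complex.exp (Complex.I * ((y : ℝ) : ℂ)) - 1‖ₑ ^ 2 * gagliardoWeight s y

theorem sq_norm_exp_sub_one_le (x : ℝ) :
    ‖Complex.exp (Complex.I * (x : ℂ)) - 1‖ ^ 2 ≤ 4 * min 1 (x ^ 2) := by
  have h1 : ‖Complex.exp (Complex.I * (x : ℂ)) - 1‖ ≤ |x| :=
    Real.norm_exp_I_mul_ofReal_sub_one_le
  have h2 : ‖Complex.exp (Complex.I * (x : ℂ)) - 1‖ ≤ 2 := by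
    refine (norm_sub_le _ _).trans ?_
    rw [mul_comm, Complex.norm_exp_ofReal_mul_I]
    norm_num
  rw [mul_min_of_nonneg _ _ (by norm_num)]
  refine le_min ?_ ?_
  · nlinarith [norm_nonneg (Complex.exp (Complex.I * (x : ℂ)) - 1)]
  · have := pow_le_pow_left₀ (norm_nonneg _) h1 2
    rw [sq_abs] at this
    nlinarith [sq_nonneg x]

theorem sq_enorm_eq_ofReal (z : ℂ) : ‖z‖ₑ ^ 2 = ENNReal.ofReal (‖z‖ ^ 2) := by
  rw [← ofReal_norm, ENNReal.ofReal_pow (norm_nonneg _)]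

theorem fourierGagliardoConst_lt_top {s : ℝ} (hs : 0 < s) (hs' : s < 2) :
    fourierGagliardoConst s < ⊤ := by
  refine lt_of_le_of_lt (b := 4 * gagliardoConst s) ?_
    (ENNReal.mul_lt_top (by simp) (gagliardoConst_lt_top hs hs'))
  rw [gagliardoConst, ← lintegral_const_mul _ (by fun_prop)]
  refine lintegral_mono fun y => ?_
  rw [← mul_assoc]
  gcongr
  rw [sq_enorm_eq_ofReal, show (4 : ENNReal) = ENNReal.ofReal 4 by simp,
    ← ENNReal.ofReal_mul (by norm_num)]
  exact ENNReal.ofReal_le_ofReal (sq_norm_exp_sub_one_le y)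

/-- Positivity is needed to divide by this constant at the end. On `(0,1)` the integrand is nonzero
because `sin(y/2) > 0`. -/
theorem fourierGagliardoConst_pos (s : ℝ) : 0 < fourierGagliardoConst s := by
  rw [fourierGagliardoConst, lintegral_pos_iff_support (by fun_prop)]
  refine lt_of_lt_of_le (b := volume (Set.Ioo (0 : ℝ) 1)) (by simp) (measure_mono fun y hy => ?_)
  have hy0 : 0 < |y| := abs_pos.mpr hy.1.ne'
  have h1 : 0 < |y| ^ (-1 - s) := by positivity
  rw [Function.mem_support]
  refine mul_ne_zero (pow_ne_zero _ ?_) ?_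
  · rw [enorm_ne_zero, ← norm_ne_zero_iff, Complex.norm_exp_I_mul_ofReal_sub_one, norm_ne_zero_iff]
    have := Real.sin_pos_of_pos_of_lt_pi (x := y / 2) (by linarith [hy.1])
      (by linarith [hy.2, Real.pi_gt_three])
    positivity
  · rw [gagliardoWeight]
    exact (ENNReal.ofReal_pos.mpr h1).ne'

theorem lintegral_exp_sub_one_gagliardoWeight {s : ℝ} (hs : 0 < s) (x : ℝ) :
    ∫⁻ y : ℝ, ‖Complex.exp (Complex.I * ((x * y : ℝ) : ℂ)) - 1‖ₑ ^ 2 * gagliardoWeight s y =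
      ENNReal.ofReal (|x| ^ s) * fourierGagliardoConst s := by
  rcases eq_or_ne x 0 with rfl | hx
  · simp [Real.zero_rpow hs.ne']
  · exact lintegral_comp_const_mul_gagliardoWeight
      (h := fun y => ‖Complex.exp (Complex.I * ((y : ℝ) : ℂ)) - 1‖ₑ ^ 2) (by fun_prop) s hx

/-! ### Increments of the Ostrovsky symbol. -/

theorem sq_norm_exp_sub_exp_le (a b : ℝ) :
    ‖Complex.exp (Complex.I * (a : ℂ)) - Complex.exp (Complex.I * (b : ℂ))‖ ^ 2 ≤
      4 * min 1 ((a - b) ^ 2) := by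
  have h : Complex.exp (Complex.I * (a : ℂ)) - Complex.exp (Complex.I * (b : ℂ)) =
      (Complex.exp (Complex.I * ((a - b : ℝ) : ℂ)) - 1) * Complex.exp (b * Complex.I) := by
    rw [sub_mul, ← Complex.exp_add, one_mul]
    congr 2
    · push_cast; ring
    · ring
  rw [h, norm_mul, Complex.norm_exp_ofReal_mul_I, mul_one]
  exact sq_norm_exp_sub_one_le _

theorem min_one_add_sq_le (p q : ℝ) :
    min 1 ((p + q) ^ 2) ≤ 2 * min 1 (p ^ 2) + 2 * min 1 (q ^ 2) := by
  rcases le_total 1 (p ^ 2) with hp | hp <;> rcases le_total 1 (q ^ 2) with hq | hq <;>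
    simp only [min_eq_left, min_eq_right, hp, hq]
  · linarith [min_le_left 1 ((p + q) ^ 2)]
  · nlinarith [min_le_left 1 ((p + q) ^ 2)]
  · nlinarith [min_le_left 1 ((p + q) ^ 2)]
  · nlinarith [min_le_right 1 ((p + q) ^ 2), sq_nonneg (p - q)]

theorem sq_norm_ostrovskySymbol_sub_le (ε t a b : ℝ) :
    ‖ostrovskySymbol ε t a - ostrovskySymbol ε t b‖ ^ 2 ≤
      8 * min 1 ((t * (a ^ 3 - b ^ 3)) ^ 2) + 8 * min 1 ((t * (ε / a - ε / b)) ^ 2) := by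
  have h1 := sq_norm_exp_sub_exp_le (t * (a ^ 3 + ε / a)) (t * (b ^ 3 + ε / b))
  have h2 := min_one_add_sq_le (t * (a ^ 3 - b ^ 3)) (t * (ε / a - ε / b))
  have h3 : t * (a ^ 3 + ε / a) - t * (b ^ 3 + ε / b) =
    t * (a ^ 3 - b ^ 3) + t * (ε / a - ε / b) := by ring
  rw [h3] at h1
  unfold ostrovskySymbol
  linarith

/-- Only `|ρy| ≤ 1` matters. There the increment is `-y` times `t(3η² - 3ηy + y²) ≤ 5tη² + 3ty²`,
and `ty² ≤ ρ(ρy)² ≤ ρ`, so the effective speed is at most `8ρ`. -/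
theorem min_one_cubic_le {t ρ η : ℝ} (ht : 0 ≤ t) (hρ : 0 ≤ ρ) (h3 : t ≤ ρ ^ 3)
    (h1 : t * η ^ 2 ≤ ρ) (y : ℝ) :
    min 1 ((t * ((η - y) ^ 3 - η ^ 3)) ^ 2) ≤ 64 * min 1 ((ρ * y) ^ 2) := by
  rcases le_total 1 ((ρ * y) ^ 2) with h | h
  · rw [min_eq_left h]
    linarith [min_le_left 1 ((t * ((η - y) ^ 3 - η ^ 3)) ^ 2)]
  · rw [min_eq_right h]
    refine (min_le_right _ _).trans ?_
    have e : t * ((η - y) ^ 3 - η ^ 3) = -(t * (3 * η ^ 2 - 3 * η * y + y ^ 2)) * y := by ring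
    have hA0 : 0 ≤ 3 * η ^ 2 - 3 * η * y + y ^ 2 := by nlinarith [sq_nonneg (3 * η - 2 * y)]
    have hA : 3 * η ^ 2 - 3 * η * y + y ^ 2 ≤ 5 * η ^ 2 + 3 * y ^ 2 := by
      nlinarith [sq_nonneg (3 * η + 2 * y)]
    have hB : t * (3 * η ^ 2 - 3 * η * y + y ^ 2) ≤ 8 * ρ := by
      have h4 : t * y ^ 2 ≤ ρ := by
        calc t * y ^ 2 ≤ ρ ^ 3 * y ^ 2 := by gcongr
          _ = ρ * (ρ * y) ^ 2 := by ring
          _ ≤ ρ * 1 := by gcongr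
          _ = ρ := mul_one _
      calc t * (3 * η ^ 2 - 3 * η * y + y ^ 2) ≤ t * (5 * η ^ 2 + 3 * y ^ 2) := by gcongr
        _ = 5 * (t * η ^ 2) + 3 * (t * y ^ 2) := by ring
        _ ≤ 8 * ρ := by linarith
    have hC : (t * (3 * η ^ 2 - 3 * η * y + y ^ 2)) ^ 2 ≤ (8 * ρ) ^ 2 :=
      pow_le_pow_left₀ (by positivity) hB 2
    calc (t * ((η - y) ^ 3 - η ^ 3)) ^ 2
        = (t * (3 * η ^ 2 - 3 * η * y + y ^ 2)) ^ 2 * y ^ 2 := by rw [e]; ring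
      _ ≤ (8 * ρ) ^ 2 * y ^ 2 := by gcongr
      _ = 64 * (ρ * y) ^ 2 := by ring

/-- Up to sign the increment is `ty/(η(η-y))`; away from the singularity the denominator is at least
`η²/2` in modulus. -/
theorem min_one_inv_le_of_far {ε t η y : ℝ} (hε : ε ^ 2 = 1) (hη : η ≠ 0)
    (hy : |η| / 2 ≤ |η - y|) :
    min 1 ((t * (ε / (η - y) - ε / η)) ^ 2) ≤ 4 * min 1 ((t / η ^ 2 * y) ^ 2) := by
  have hη' : 0 < |η| := abs_pos.mpr hη
  have hu : η - y ≠ 0 := abs_pos.mp (lt_of_lt_of_le (by positivity) hy)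
  have hsq : η ^ 2 ≤ 4 * (η - y) ^ 2 := by
    have := pow_le_pow_left₀ (by positivity) hy 2
    rw [div_pow, sq_abs, sq_abs] at this
    linarith
  have e : (t * (ε / (η - y) - ε / η)) ^ 2 = (t * y) ^ 2 / (η ^ 2 * (η - y) ^ 2) := by
    have : t * (ε / (η - y) - ε / η) = ε * (t * y / (η * (η - y))) := by field_simp; ring
    rw [this, mul_pow, hε, one_mul, div_pow, mul_pow η]
  have h : (t * (ε / (η - y) - ε / η)) ^ 2 ≤ 4 * (t / η ^ 2 * y) ^ 2 := by
    rw [e, show 4 * (t / η ^ 2 * y) ^ 2 = (t * y) ^ 2 / (η ^ 2 * (η ^ 2 / 4)) by field_simp]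
    have : 0 < η ^ 2 := by positivity
    gcongr
    linarith
  rw [mul_min_of_nonneg _ _ (by norm_num)]
  exact min_le_min (by norm_num) h

/-- Here `|y| ≤ 3|η|/2`, so the factor `y/η` is harmless and only the singular variable `u = η - y`
remains. -/
theorem min_one_inv_le_of_near {ε t η y : ℝ} (hε : ε ^ 2 = 1) (hη : η ≠ 0) (hu : η - y ≠ 0)
    (hy : |η - y| ≤ |η| / 2) :
    min 1 ((t * (ε / (η - y) - ε / η)) ^ 2) ≤ 3 * min 1 ((t / (η - y)) ^ 2) := by
  have hy2 : y ^ 2 ≤ 3 * η ^ 2 := by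
    have h1 : |y| ≤ 3 / 2 * |η| := by
      calc |y| = |η - (η - y)| := by ring_nf
        _ ≤ |η| + |η - y| := abs_sub _ _
        _ ≤ 3 / 2 * |η| := by linarith
    have := pow_le_pow_left₀ (abs_nonneg y) h1 2
    rw [mul_pow, sq_abs, sq_abs] at this
    nlinarith [sq_nonneg η]
  have e : (t * (ε / (η - y) - ε / η)) ^ 2 = (t / (η - y)) ^ 2 * (y ^ 2 / η ^ 2) := by
    have : t * (ε / (η - y) - ε / η) = ε * (t / (η - y) * (y / η)) := by field_simp; ring
    rw [this, mul_pow, hε, one_mul, mul_pow, div_pow y]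
  have h : (t * (ε / (η - y) - ε / η)) ^ 2 ≤ 3 * (t / (η - y)) ^ 2 := by
    rw [e, mul_comm 3]
    gcongr
    rw [div_le_iff₀ (by positivity)]
    exact hy2
  rw [mul_min_of_nonneg _ _ (by norm_num)]
  exact min_le_min (by norm_num) h

theorem gagliardoWeight_le_of_near {s η y : ℝ} (hs : 0 < s) (hs' : s ≤ 1) (hη : η ≠ 0)
    (hy : |η - y| ≤ |η| / 2) :
    gagliardoWeight s y ≤ ENNReal.ofReal (4 * |η| ^ (-1 - s)) := by
  have hη' : 0 < |η| := abs_pos.mpr hη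
  have h1 : |η| / 2 ≤ |y| := by
    have := abs_sub_abs_le_abs_sub η y
    linarith
  apply ENNReal.ofReal_le_ofReal
  calc |y| ^ (-1 - s) ≤ (|η| / 2) ^ (-1 - s) :=
        Real.rpow_le_rpow_of_nonpos (by positivity) h1 (by linarith)
    _ = (2 : ℝ) ^ (1 + s) * |η| ^ (-1 - s) := by
        rw [Real.div_rpow (by positivity) (by norm_num), div_eq_mul_inv, mul_comm,
          ← Real.rpow_neg (by norm_num)]
        congr 2
        ring
    _ ≤ (2 : ℝ) ^ (2 : ℝ) * |η| ^ (-1 - s) := by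
        gcongr
        · norm_num
        · linarith
    _ = 4 * |η| ^ (-1 - s) := by norm_num

/-- Since `min(1,(t/u)²) = t² min(1,(u/t)²) u⁻²`, this is the Gagliardo integral with exponent `1`.
-/
theorem lintegral_min_one_div_sq {t : ℝ} (ht : 0 < t) :
    ∫⁻ u : ℝ, ENNReal.ofReal (min 1 ((t / u) ^ 2)) = ENNReal.ofReal t * gagliardoConst 1 := by
  have h1 : ∀ᵐ u : ℝ, ENNReal.ofReal (min 1 ((t / u) ^ 2)) = ENNReal.ofReal (t ^ 2) *
      (ENNReal.ofReal (min 1 ((t⁻¹ * u) ^ 2)) * gagliardoWeight 1 u) := by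
    filter_upwards [Measure.ae_ne volume 0] with u hu
    rw [gagliardoWeight, ← ENNReal.ofReal_mul (by positivity),
      ← ENNReal.ofReal_mul (by positivity)]
    congr 1
    have e : |u| ^ (-1 - 1 : ℝ) = (u ^ 2)⁻¹ := by
      rw [show (-1 - 1 : ℝ) = -2 by norm_num, Real.rpow_neg (abs_nonneg _), Real.rpow_two, sq_abs]
    rw [e, ← mul_assoc, mul_min_of_nonneg _ _ (by positivity), min_mul_of_nonneg _ _ (by positivity),
      min_comm]
    congr 1 <;> field_simp
  rw [lintegral_congr_ae h1, lintegral_const_mul _ (by fun_prop),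
    lintegral_min_one_sq_gagliardoWeight (inv_pos.mpr ht), ← mul_assoc,
    ← ENNReal.ofReal_mul (by positivity), Real.rpow_one]
  congr 2
  field_simp

/-- Interpolation: the integral is at most the length `|η|` of the interval and at most a multiple
of `t`; take powers `1-s` and `s`. -/
theorem setLIntegral_min_one_div_sq_le {s t η : ℝ} (hs : 0 < s) (hs' : s ≤ 1) (ht : 0 < t)
    (hη : η ≠ 0) :
    ∫⁻ u in {u : ℝ | |u| ≤ |η| / 2}, ENNReal.ofReal (min 1 ((t / u) ^ 2)) ≤
      ENNReal.ofReal (|η| ^ (1 - s) * t ^ s) * gagliardoConst 1 ^ s := by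
  have hη' : 0 < |η| := abs_pos.mpr hη
  set I := ∫⁻ u in {u : ℝ | |u| ≤ |η| / 2}, ENNReal.ofReal (min 1 ((t / u) ^ 2))
  have h1 : I ≤ ENNReal.ofReal |η| := by
    calc I ≤ ∫⁻ u in {u : ℝ | |u| ≤ |η| / 2}, 1 := by
          refine lintegral_mono fun u => ?_
          rw [← ENNReal.ofReal_one]
          exact ENNReal.ofReal_le_ofReal (min_le_left _ _)
      _ = ENNReal.ofReal |η| := by
          rw [setLIntegral_one, show {u : ℝ | |u| ≤ |η| / 2} = Set.Icc (-(|η| / 2)) (|η| / 2) by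
            ext u; simp [abs_le], Real.volume_Icc]
          congr 1
          ring
  have h2 : I ≤ ENNReal.ofReal t * gagliardoConst 1 :=
    (setLIntegral_le_lintegral _ _).trans (lintegral_min_one_div_sq ht).le
  calc I = I ^ (1 - s) * I ^ s := by
        rw [← ENNReal.rpow_add_of_nonneg _ _ (by linarith) hs.le]
        simp
    _ ≤ ENNReal.ofReal |η| ^ (1 - s) * (ENNReal.ofReal t * gagliardoConst 1) ^ s := by
        gcongr
    _ = ENNReal.ofReal (|η| ^ (1 - s) * t ^ s) * gagliardoConst 1 ^ s := by
        rw [ENNReal.mul_rpow_of_nonneg _ _ hs.le, ENNReal.ofReal_rpow_of_pos ht,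
          ENNReal.ofReal_rpow_of_pos hη', ENNReal.ofReal_mul (by positivity), mul_assoc]

theorem lintegral_inv_phase_le {s ε t η : ℝ} (hs : 0 < s) (hs' : s ≤ 1) (hε : ε ^ 2 = 1)
    (ht : 0 < t) (hη : η ≠ 0) :
    ∫⁻ y, ENNReal.ofReal (min 1 ((t * (ε / (η - y) - ε / η)) ^ 2)) * gagliardoWeight s y ≤
      (4 * gagliardoConst s + 12 * gagliardoConst 1 ^ s) * ENNReal.ofReal ((t / η ^ 2) ^ s) := by
  have hη' : 0 < |η| := abs_pos.mpr hη
  have hS : MeasurableSet {u : ℝ | |u| ≤ |η| / 2} := measurableSet_le (by fun_prop) (by fun_prop)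
  set g : ℝ → ENNReal := {u : ℝ | |u| ≤ |η| / 2}.indicator
    fun u => ENNReal.ofReal (min 1 ((t / u) ^ 2)) with hg
  have hgm : Measurable g := by
    refine Measurable.indicator ?_ hS
    fun_prop
  -- Far from `y = η` the phase is compared with a linear one; near it the weight is at most
  -- `4|η|^(-1-s)`, and `12 = 3 · 4`.
  have hpt : ∀ᵐ y : ℝ, ENNReal.ofReal (min 1 ((t * (ε / (η - y) - ε / η)) ^ 2)) *
      gagliardoWeight s y ≤
      4 * (ENNReal.ofReal (min 1 ((t / η ^ 2 * y) ^ 2)) * gagliardoWeight s y) +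
      ENNReal.ofReal (12 * |η| ^ (-1 - s)) * g (η - y) := by
    filter_upwards [Measure.ae_ne volume η] with y hy
    have hu : η - y ≠ 0 := sub_ne_zero.mpr hy.symm
    rcases le_total (|η| / 2) |η - y| with h | h
    · refine le_trans ?_ le_self_add
      rw [← mul_assoc]
      gcongr
      rw [show (4 : ENNReal) = ENNReal.ofReal 4 by simp, ← ENNReal.ofReal_mul (by norm_num)]
      exact ENNReal.ofReal_le_ofReal (min_one_inv_le_of_far hε hη h)
    · refine le_trans ?_ le_add_self
      have hgy : g (η - y) = ENNReal.ofReal (min 1 ((t / (η - y)) ^ 2)) :=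
        Set.indicator_of_mem (s := {u : ℝ | |u| ≤ |η| / 2}) h _
      rw [hgy]
      calc _ ≤ ENNReal.ofReal (3 * min 1 ((t / (η - y)) ^ 2)) *
            ENNReal.ofReal (4 * |η| ^ (-1 - s)) :=
            mul_le_mul' (ENNReal.ofReal_le_ofReal (min_one_inv_le_of_near hε hη hu h))
              (gagliardoWeight_le_of_near hs hs' hη h)
        _ = _ := by
            rw [← ENNReal.ofReal_mul (by positivity), ← ENNReal.ofReal_mul (by positivity)]
            congr 1
            ring
  refine (lintegral_mono_ae hpt).trans ?_
  rw [lintegral_add_left (by fun_prop), lintegral_const_mul _ (by fun_prop),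
    lintegral_const_mul _ (by fun_prop), lintegral_min_one_sq_gagliardoWeight (by positivity),
    lintegral_sub_left_eq_self g η, hg, lintegral_indicator hS, add_mul]
  gcongr ?_ + ?_
  · rw [mul_assoc, mul_comm (gagliardoConst s)]
  · refine (mul_le_mul_right (setLIntegral_min_one_div_sq_le hs hs' ht hη) _).trans (le_of_eq ?_)
    have e : 12 * |η| ^ (-1 - s) * (|η| ^ (1 - s) * t ^ s) = 12 * (t / η ^ 2) ^ s := by
      rw [Real.div_rpow ht.le (by positivity), ← sq_abs η, ← Real.rpow_two,
        ← Real.rpow_mul hη'.le, div_eq_mul_inv, ← Real.rpow_neg hη'.le, mul_assoc 12,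
        ← mul_assoc (|η| ^ (-1 - s)), ← Real.rpow_add hη', mul_comm (t ^ s)]
      congr 3
      ring
    rw [← mul_assoc, ← ENNReal.ofReal_mul (by positivity), e, ENNReal.ofReal_mul (by norm_num),
      mul_right_comm]
    simp

theorem lintegral_cubic_phase_le {s t : ℝ} (hs : 0 < s) (hs' : s ≤ 1) (ht : 0 < t) (η : ℝ) :
    ∫⁻ y, ENNReal.ofReal (min 1 ((t * ((η - y) ^ 3 - η ^ 3)) ^ 2)) * gagliardoWeight s y ≤
      64 * gagliardoConst s * ENNReal.ofReal (t ^ (s / 3) + t ^ s * (|η| ^ s) ^ 2) := by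
  -- The two terms secure `t ≤ ρ³` and `tη² ≤ ρ`; `s ≤ 1` makes `ρ^s` subadditive in them.
  set ρ := t ^ (1 / 3 : ℝ) + t * η ^ 2 with hρ
  have hρ0 : 0 < ρ := by positivity
  have h3 : t ≤ ρ ^ 3 := by
    calc t = (t ^ (1 / 3 : ℝ)) ^ 3 := by
          rw [← Real.rpow_natCast, ← Real.rpow_mul ht.le]; norm_num
      _ ≤ ρ ^ 3 := by
          gcongr
          rw [hρ]
          have : 0 ≤ t * η ^ 2 := by positivity
          linarith
  have h1 : t * η ^ 2 ≤ ρ := by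
    have : 0 ≤ t ^ (1 / 3 : ℝ) := by positivity
    linarith
  have hr : ρ ^ s ≤ t ^ (s / 3) + t ^ s * (|η| ^ s) ^ 2 := by
    refine (Real.rpow_add_le_add_rpow (by positivity) (by positivity) hs.le hs').trans (le_of_eq ?_)
    rw [← Real.rpow_mul ht.le, Real.mul_rpow ht.le (by positivity), ← sq_abs η,
      ← Real.rpow_natCast (|η|) 2, ← Real.rpow_natCast (|η| ^ s) 2, ← Real.rpow_mul (abs_nonneg _),
      ← Real.rpow_mul (abs_nonneg _)]
    congr 2
    · ring
    · congr 1; push_cast; ring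
  calc _ ≤ ∫⁻ y, 64 * (ENNReal.ofReal (min 1 ((ρ * y) ^ 2)) * gagliardoWeight s y) := by
        refine lintegral_mono fun y => ?_
        rw [← mul_assoc]
        gcongr
        rw [show (64 : ENNReal) = ENNReal.ofReal 64 by simp, ← ENNReal.ofReal_mul (by norm_num)]
        exact ENNReal.ofReal_le_ofReal (min_one_cubic_le ht.le hρ0.le h3 h1 y)
    _ = 64 * gagliardoConst s * ENNReal.ofReal (ρ ^ s) := by
        rw [lintegral_const_mul _ (by fun_prop), lintegral_min_one_sq_gagliardoWeight hρ0,
          mul_assoc, mul_comm (gagliardoConst s)]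
    _ ≤ _ := by gcongr

theorem measurable_ostrovskySymbol (ε t : ℝ) : Measurable (ostrovskySymbol ε t) := by
  unfold ostrovskySymbol
  fun_prop

theorem exists_lintegral_ostrovskySymbol_sub_le {s : ℝ} (hs : 0 < s) (hs' : s ≤ 1) :
    ∃ C : ENNReal, C < ⊤ ∧ ∀ ε : ℝ, ε ^ 2 = 1 → ∀ t : ℝ, 0 ≤ t → ∀ η : ℝ, η ≠ 0 →
      ∫⁻ y, ‖ostrovskySymbol ε t (η - y) - ostrovskySymbol ε t η‖ₑ ^ 2 * gagliardoWeight s y ≤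
        C * ENNReal.ofReal (t ^ (s / 3) + t ^ s * (|η| ^ s) ^ 2 + t ^ s * (|η| ^ (-s)) ^ 2) := by
  have hJ := gagliardoConst_lt_top hs (by linarith)
  have hJ1 : gagliardoConst 1 ^ s < ⊤ :=
    ENNReal.rpow_lt_top_of_nonneg hs.le (gagliardoConst_lt_top one_pos (by norm_num)).ne
  refine ⟨8 * (64 * gagliardoConst s) + 8 * (4 * gagliardoConst s + 12 * gagliardoConst 1 ^ s),
    ?_, fun ε hε t ht η hη => ?_⟩
  · finiteness
  rcases ht.eq_or_lt with rfl | ht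
  · simp [ostrovskySymbol]
  have hη' : 0 < |η| := abs_pos.mpr hη
  set A := t ^ (s / 3) + t ^ s * (|η| ^ s) ^ 2
  have hB : (t / η ^ 2) ^ s = t ^ s * (|η| ^ (-s)) ^ 2 := by
    rw [Real.div_rpow ht.le (by positivity), ← sq_abs η, Real.rpow_neg hη'.le, inv_pow,
      div_eq_mul_inv, ← Real.rpow_natCast (|η|) 2, ← Real.rpow_natCast (|η| ^ s) 2,
      ← Real.rpow_mul hη'.le, ← Real.rpow_mul hη'.le, mul_comm s]
  rw [← hB]
  calc _ ≤ ∫⁻ y, (8 * (ENNReal.ofReal (min 1 ((t * ((η - y) ^ 3 - η ^ 3)) ^ 2)) *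
            gagliardoWeight s y) +
          8 * (ENNReal.ofReal (min 1 ((t * (ε / (η - y) - ε / η)) ^ 2)) *
            gagliardoWeight s y)) := by
        refine lintegral_mono fun y => ?_
        rw [← mul_assoc, ← mul_assoc, ← add_mul]
        gcongr
        rw [sq_enorm_eq_ofReal, show (8 : ENNReal) = ENNReal.ofReal 8 by simp,
          ← ENNReal.ofReal_mul (by norm_num), ← ENNReal.ofReal_mul (by norm_num),
          ← ENNReal.ofReal_add (by positivity) (by positivity)]
        exact ENNReal.ofReal_le_ofReal (sq_norm_ostrovskySymbol_sub_le ε t _ _)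
    _ ≤ 8 * (64 * gagliardoConst s * ENNReal.ofReal A) +
          8 * ((4 * gagliardoConst s + 12 * gagliardoConst 1 ^ s) *
            ENNReal.ofReal ((t / η ^ 2) ^ s)) := by
        rw [lintegral_add_left (by fun_prop), lintegral_const_mul _ (by fun_prop),
          lintegral_const_mul _ (by fun_prop)]
        gcongr
        · exact lintegral_cubic_phase_le hs hs' ht η
        · exact lintegral_inv_phase_le hs hs' hε ht hη
    _ = 8 * (64 * gagliardoConst s) * ENNReal.ofReal A +
          8 * (4 * gagliardoConst s + 12 * gagliardoConst 1 ^ s) *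
            ENNReal.ofReal ((t / η ^ 2) ^ s) := by ring
    _ ≤ _ := by
        rw [add_mul (8 * (64 * gagliardoConst s))]
        have hA : 0 ≤ A := by positivity
        have hB' : 0 ≤ (t / η ^ 2) ^ s := by positivity
        gcongr
        · linarith
        · linarith

/-! ### Sobolev regularity and fractional derivatives. -/

/-- The inverse Bessel weight is bounded for `s ≥ 0`, so the relation can be inverted among
distributions; injectivity of `L²` into them makes it hold almost everywhere. -/
theorem ae_eq_mul_of_smulLeftCLM_eq {s : ℝ} (hs : 0 ≤ s) {f u : L2R}
    (hu : TemperedDistribution.smulLeftCLM ℂ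
      (fun x : ℝ => (((1 + ‖x‖ ^ 2) ^ (s / 2) : ℝ) : ℂ)) (f : TemperedDistribution ℝ ℂ) =
        (u : TemperedDistribution ℝ ℂ)) :
    ∀ᵐ x, f x = (((1 + ‖x‖ ^ 2) ^ (-s / 2) : ℝ) : ℂ) * u x := by
  have hw : MemLp (fun x : ℝ => (((1 + ‖x‖ ^ 2) ^ (-s / 2) : ℝ) : ℂ)) ⊤ volume := by
    refine memLp_top_of_bound (Measurable.aestronglyMeasurable (by fun_prop)) 1
      (Filter.Eventually.of_forall fun x => ?_)
    rw [Complex.norm_real, Real.norm_eq_abs, abs_of_nonneg (by positivity)]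
    exact Real.rpow_le_one_of_one_le_of_nonpos (by linarith [sq_nonneg ‖x‖]) (by linarith)
  have hg : (fun x : ℝ => (((1 + ‖x‖ ^ 2) ^ (-s / 2) : ℝ) : ℂ)).HasTemperateGrowth := by fun_prop
  have h1 : ((hw.toLp _ • u : L2R) : TemperedDistribution ℝ ℂ) =
      (f : TemperedDistribution ℝ ℂ) := by
    rw [Lp.toTemperedDistribution_smul_eq hg, ← hu,
      TemperedDistribution.smulLeftCLM_smulLeftCLM_apply (by fun_prop) (by fun_prop)]
    convert! TemperedDistribution.smulLeftCLM_const 1 (f : TemperedDistribution ℝ ℂ) using 1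
    · congr
      ext x
      rw [Pi.mul_apply]
      norm_cast
      rw [← Real.rpow_add (by positivity)]
      ring_nf
      simp
    · simp
  have h2 : (hw.toLp _ • u : L2R) = f :=
    LinearMap.ker_eq_bot.mp (Lp.ker_toTemperedDistributionCLM_eq_bot (F := ℂ) (p := 2)) h1
  rw [← h2]
  filter_upwards [Lp.coeFn_lpSMul (r := 2) (hw.toLp _) u, hw.coeFn_toLp] with x h3 h4
  rw [h3, Pi.smul_apply', h4, smul_eq_mul]

/-- From `|x|^s ≤ (1+x²)^(s/2)`. This ensures that `fracDeriv (2 * b) f` is the true derivative and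
not its default value `0`. -/
theorem hasFracDeriv_of_memSobolev {s : ℝ} (hs : 0 ≤ s) {f : L2R}
    (hf : TemperedDistribution.MemSobolev s 2 (f : TemperedDistribution ℝ ℂ)) :
    HasFracDeriv s f := by
  obtain ⟨u, hu⟩ := TemperedDistribution.memSobolev_iff_exists_smulLeftCLM_fourier.mp hf
  rw [Lp.fourier_toTemperedDistribution_eq f] at hu
  have hm : Measurable fun ξ : ℝ => fracSymbol s (2 * Real.pi * ξ) := by
    unfold fracSymbol
    fun_prop
  refine (Lp.memLp u).of_le_mul (c := (2 * Real.pi) ^ s)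
    (hm.aestronglyMeasurable.mul (Lp.aestronglyMeasurable (𝓕 f : L2R))) ?_
  filter_upwards [ae_eq_mul_of_smulLeftCLM_eq hs hu] with x hx
  rw [symbolMul, fracSymbol, hx, ← mul_assoc, norm_mul, norm_mul, Complex.norm_real,
    Complex.norm_real, Real.norm_of_nonneg (by positivity), Real.norm_of_nonneg (by positivity),
    abs_mul, abs_of_pos Real.two_pi_pos, Real.mul_rpow Real.two_pi_pos.le (abs_nonneg _)]
  refine mul_le_mul_of_nonneg_right ?_ (norm_nonneg _)
  rw [mul_assoc]
  refine mul_le_of_le_one_right (by positivity) ?_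
  rw [neg_div, Real.rpow_neg (by positivity), ← div_eq_mul_inv]
  refine div_le_one_of_le₀ ?_ (by positivity)
  calc |x| ^ s = (|x| ^ 2) ^ (s / 2) := by
        rw [← Real.rpow_two, ← Real.rpow_mul (abs_nonneg _)]
        congr 1
        ring
    _ ≤ (1 + ‖x‖ ^ 2) ^ (s / 2) := by
        rw [Real.norm_eq_abs]
        gcongr
        linarith

theorem sq_enorm_fracDeriv {σ : ℝ} {f : L2R} (h : HasFracDeriv σ f) :
    ‖fracDeriv σ f‖ₑ ^ 2 =
      ∫⁻ ξ, ENNReal.ofReal ((|2 * Real.pi * ξ| ^ σ) ^ 2) * ‖(𝓕 f : L2R) ξ‖ₑ ^ 2 := by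
  have h1 : ‖fracDeriv σ f‖ₑ = ‖h.toLp (symbolMul (fracSymbol σ) f)‖ₑ := by
    rw [fracDeriv, dif_pos h, ← ofReal_norm, ← ofReal_norm]
    congr 1
    exact (Lp.fourierTransformₗᵢ ℝ ℂ).symm.norm_map _
  rw [h1, sq_enorm_eq_lintegral]
  refine lintegral_congr_ae ?_
  filter_upwards [MemLp.coeFn_toLp h] with ξ hξ
  rw [hξ, symbolMul, enorm_mul, mul_pow, fracSymbol, sq_enorm_eq_ofReal, Complex.norm_real,
    Real.norm_of_nonneg (by positivity)]

theorem sq_enorm_eq_lintegral_fourier (f : L2R) : ‖f‖ₑ ^ 2 = ∫⁻ ξ, ‖(𝓕 f : L2R) ξ‖ₑ ^ 2 := by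
  rw [← sq_enorm_eq_lintegral, ← ofReal_norm, ← ofReal_norm, Lp.norm_fourier_eq]

/-! ### The weighted estimate on the Fourier side. -/

/-- The weighted `L²` norm as a Gagliardo seminorm of the Fourier transform. -/
theorem lintegral_gagliardo_fourier {s : ℝ} (hs : 0 < s) (f : L2R) :
    ∫⁻ y, (∫⁻ ξ, ‖(𝓕 f : L2R) (ξ - y) - (𝓕 f : L2R) ξ‖ₑ ^ 2) * gagliardoWeight s y =
      ENNReal.ofReal ((2 * Real.pi) ^ s) * fourierGagliardoConst s *
        ∫⁻ x, ENNReal.ofReal (|x| ^ s) * ‖f x‖ₑ ^ 2 := by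
  have hf := (Lp.stronglyMeasurable f).measurable
  simp_rw [lintegral_fourier_sub]
  have h1 : ∀ y : ℝ, (∫⁻ x, ‖Complex.exp (Complex.I * ((2 * Real.pi * (y * x) : ℝ) : ℂ)) - 1‖ₑ ^ 2
        * ‖f x‖ₑ ^ 2) * gagliardoWeight s y =
      ∫⁻ x, ‖f x‖ₑ ^ 2 *
        (‖Complex.exp (Complex.I * ((2 * Real.pi * x * y : ℝ) : ℂ)) - 1‖ₑ ^ 2 *
          gagliardoWeight s y) := by
    intro y
    rw [← lintegral_mul_const _ (by fun_prop)]
    refine lintegral_congr fun x => ?_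
    rw [show 2 * Real.pi * (y * x) = 2 * Real.pi * x * y by ring]
    ring
  simp_rw [h1]
  rw [lintegral_lintegral_swap (by fun_prop), ← lintegral_const_mul _ (by fun_prop)]
  refine lintegral_congr fun x => ?_
  rw [lintegral_const_mul _ (by fun_prop), lintegral_exp_sub_one_gagliardoWeight hs, abs_mul,
    abs_of_pos Real.two_pi_pos, Real.mul_rpow Real.two_pi_pos.le (abs_nonneg _),
    ENNReal.ofReal_mul (by positivity)]
  ring

theorem sq_enorm_add_le (z w : ℂ) : ‖z + w‖ₑ ^ 2 ≤ 2 * ‖z‖ₑ ^ 2 + 2 * ‖w‖ₑ ^ 2 := by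
  rw [sq_enorm_eq_ofReal, sq_enorm_eq_ofReal, sq_enorm_eq_ofReal,
    show (2 : ENNReal) = ENNReal.ofReal 2 by simp, ← ENNReal.ofReal_mul (by norm_num),
    ← ENNReal.ofReal_mul (by norm_num), ← ENNReal.ofReal_add (by positivity) (by positivity)]
  apply ENNReal.ofReal_le_ofReal
  have := pow_le_pow_left₀ (norm_nonneg _) (norm_add_le z w) 2
  nlinarith [sq_nonneg (‖z‖ - ‖w‖)]

theorem norm_ostrovskySymbol (ε t η : ℝ) : ‖ostrovskySymbol ε t η‖ = 1 := by
  rw [ostrovskySymbol, mul_comm, Complex.norm_exp_ofReal_mul_I]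

theorem fourier_ostrovskyGroup_ae (ε t : ℝ) (f : L2R) :
    ∀ᵐ ξ, (𝓕 (ostrovskyGroup ε t f) : L2R) ξ =
      ostrovskySymbol ε t (2 * Real.pi * ξ) * (𝓕 f : L2R) ξ := by
  have h : (𝓕 (ostrovskyGroup ε t f) : L2R) =
      (memLp_ostrovskySymbol_mul ε t f).toLp (symbolMul (ostrovskySymbol ε t) f) :=
    (Lp.fourierTransformₗᵢ ℝ ℂ).apply_symm_apply _
  rw [h]
  exact (memLp_ostrovskySymbol_mul ε t f).coeFn_toLp

/-- In the product increment the shifted, unimodular symbol goes with the increment of `𝓕 f`, and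
the unshifted `𝓕 f` with that of the symbol, so `‖𝓕 f ξ‖²` later leaves the `y` integral. -/
theorem lintegral_fourier_ostrovskyGroup_sub_le (ε t : ℝ) (f : L2R) (y : ℝ) :
    ∫⁻ ξ, ‖(𝓕 (ostrovskyGroup ε t f) : L2R) (ξ - y) -
        (𝓕 (ostrovskyGroup ε t f) : L2R) ξ‖ₑ ^ 2 ≤
      2 * (∫⁻ ξ, ‖(𝓕 f : L2R) (ξ - y) - (𝓕 f : L2R) ξ‖ₑ ^ 2) +
      2 * ∫⁻ ξ, ‖(𝓕 f : L2R) ξ‖ₑ ^ 2 *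
        ‖ostrovskySymbol ε t (2 * Real.pi * ξ - 2 * Real.pi * y) -
          ostrovskySymbol ε t (2 * Real.pi * ξ)‖ₑ ^ 2 := by
  have hF := (Lp.stronglyMeasurable (𝓕 f : L2R)).measurable
  have hm := measurable_ostrovskySymbol ε t
  rw [← lintegral_const_mul _ (by fun_prop), ← lintegral_const_mul _ (by fun_prop),
    ← lintegral_add_left (by fun_prop)]
  have h1 := fourier_ostrovskyGroup_ae ε t f
  have h2 := (measurePreserving_sub_const y).quasiMeasurePreserving.ae h1
  refine lintegral_mono_ae ?_
  filter_upwards [h1, h2] with ξ h1 h2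
  rw [h1, h2, mul_sub (2 * Real.pi)]
  set m := ostrovskySymbol ε t (2 * Real.pi * ξ - 2 * Real.pi * y) with hm'
  have e : m * (𝓕 f : L2R) (ξ - y) - ostrovskySymbol ε t (2 * Real.pi * ξ) * (𝓕 f : L2R) ξ =
      m * ((𝓕 f : L2R) (ξ - y) - (𝓕 f : L2R) ξ) +
        (𝓕 f : L2R) ξ * (m - ostrovskySymbol ε t (2 * Real.pi * ξ)) := by ring
  have hn : ‖m‖ₑ = 1 := by rw [← ofReal_norm, hm', norm_ostrovskySymbol, ENNReal.ofReal_one]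
  rw [e]
  refine (sq_enorm_add_le _ _).trans_eq ?_
  rw [enorm_mul, enorm_mul, hn, one_mul, mul_pow]

/-- The weighted estimate in squared form. -/
theorem exists_lintegral_ostrovskyGroup_le {s : ℝ} (hs : 0 < s) (hs' : s ≤ 1) :
    ∃ C : ENNReal, C < ⊤ ∧ ∀ ε : ℝ, ε ^ 2 = 1 → ∀ t : ℝ, 0 ≤ t → ∀ f : L2R,
      HasFracDeriv s f → HasFracDeriv (-s) f →
      ∫⁻ x, ENNReal.ofReal (|x| ^ s) * ‖ostrovskyGroup ε t f x‖ₑ ^ 2 ≤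
        2 * (∫⁻ x, ENNReal.ofReal (|x| ^ s) * ‖f x‖ₑ ^ 2) +
        C * (ENNReal.ofReal (t ^ (s / 3)) * ‖f‖ₑ ^ 2 +
          ENNReal.ofReal (t ^ s) * ‖fracDeriv s f‖ₑ ^ 2 +
          ENNReal.ofReal (t ^ s) * ‖fracDeriv (-s) f‖ₑ ^ 2) := by
  obtain ⟨C, hC, hker⟩ := exists_lintegral_ostrovskySymbol_sub_le hs hs'
  set K := fourierGagliardoConst s with hK
  have hK0 : K ≠ 0 := (fourierGagliardoConst_pos s).ne'
  have hK1 : K ≠ ⊤ := (fourierGagliardoConst_lt_top hs (by linarith)).ne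
  refine ⟨2 * (K⁻¹ * C), ENNReal.mul_lt_top (by simp)
    (ENNReal.mul_lt_top (ENNReal.inv_lt_top.mpr (pos_iff_ne_zero.mpr hK0)) hC),
    fun ε hε t ht f h1 h2 => ?_⟩
  have hF := (Lp.stronglyMeasurable (𝓕 f : L2R)).measurable
  have hm := measurable_ostrovskySymbol ε t
  set P := ENNReal.ofReal ((2 * Real.pi) ^ s) with hP
  have hP0 : P ≠ 0 := (ENNReal.ofReal_pos.mpr (by positivity)).ne'
  have hP1 : P ≠ ⊤ := ENNReal.ofReal_ne_top
  set A := ENNReal.ofReal (t ^ (s / 3)) * ‖f‖ₑ ^ 2 +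
          ENNReal.ofReal (t ^ s) * ‖fracDeriv s f‖ₑ ^ 2 +
          ENNReal.ofReal (t ^ s) * ‖fracDeriv (-s) f‖ₑ ^ 2 with hA
  set Nf := ∫⁻ x, ENNReal.ofReal (|x| ^ s) * ‖f x‖ₑ ^ 2
  set Ng := ∫⁻ x, ENNReal.ofReal (|x| ^ s) * ‖ostrovskyGroup ε t f x‖ₑ ^ 2
  -- Tonelli puts the `y` integral inside; rescaling `y` by `2π` yields `P` and the kernel bound at
  -- `η = 2πξ`.
  have hmult : ∫⁻ y, (∫⁻ ξ, ‖(𝓕 f : L2R) ξ‖ₑ ^ 2 *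
        ‖ostrovskySymbol ε t (2 * Real.pi * ξ - 2 * Real.pi * y) -
          ostrovskySymbol ε t (2 * Real.pi * ξ)‖ₑ ^ 2) * gagliardoWeight s y ≤ P * (C * A) := by
    rw [lintegral_congr fun y => (lintegral_mul_const _ (by fun_prop)).symm]
    rw [lintegral_lintegral_swap (by fun_prop)]
    calc _ ≤ ∫⁻ ξ, P * (C * (ENNReal.ofReal (t ^ (s / 3)) * ‖(𝓕 f : L2R) ξ‖ₑ ^ 2 +
            ENNReal.ofReal (t ^ s) * (ENNReal.ofReal ((|2 * Real.pi * ξ| ^ s) ^ 2) *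
              ‖(𝓕 f : L2R) ξ‖ₑ ^ 2) +
            ENNReal.ofReal (t ^ s) * (ENNReal.ofReal ((|2 * Real.pi * ξ| ^ (-s)) ^ 2) *
              ‖(𝓕 f : L2R) ξ‖ₑ ^ 2))) := by
          refine lintegral_mono_ae ?_
          filter_upwards [Measure.ae_ne volume 0] with ξ hξ
          have hη : 2 * Real.pi * ξ ≠ 0 := mul_ne_zero Real.two_pi_pos.ne' hξ
          simp_rw [mul_assoc (‖(𝓕 f : L2R) ξ‖ₑ ^ 2)]
          rw [lintegral_const_mul _ (by fun_prop),
            lintegral_comp_const_mul_gagliardoWeight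
              (h := fun z => ‖ostrovskySymbol ε t (2 * Real.pi * ξ - z) -
                ostrovskySymbol ε t (2 * Real.pi * ξ)‖ₑ ^ 2) (by fun_prop) s Real.two_pi_pos.ne',
            abs_of_pos Real.two_pi_pos, ← hP, mul_left_comm]
          refine mul_le_mul_right ((mul_le_mul_right (hker ε hε t ht _ hη) _).trans_eq ?_) _
          rw [ENNReal.ofReal_add (by positivity) (by positivity),
            ENNReal.ofReal_add (by positivity) (by positivity),
            ENNReal.ofReal_mul (by positivity), ENNReal.ofReal_mul (by positivity)]
          ring
      _ = P * (C * A) := by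
          rw [lintegral_const_mul _ (by fun_prop), lintegral_const_mul _ (by fun_prop),
            lintegral_add_left (by fun_prop), lintegral_add_left (by fun_prop),
            lintegral_const_mul _ (by fun_prop), lintegral_const_mul _ (by fun_prop),
            lintegral_const_mul _ (by fun_prop), hA, sq_enorm_fracDeriv h1,
            sq_enorm_fracDeriv h2, sq_enorm_eq_lintegral_fourier f]
  have key : P * K * Ng ≤ P * K * (2 * Nf + 2 * (K⁻¹ * C) * A) := by
    calc P * K * Ng = _ := (lintegral_gagliardo_fourier hs (ostrovskyGroup ε t f)).symm
      _ ≤ ∫⁻ y, (2 * ((∫⁻ ξ, ‖(𝓕 f : L2R) (ξ - y) - (𝓕 f : L2R) ξ‖ₑ ^ 2) *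
            gagliardoWeight s y) +
          2 * ((∫⁻ ξ, ‖(𝓕 f : L2R) ξ‖ₑ ^ 2 *
            ‖ostrovskySymbol ε t (2 * Real.pi * ξ - 2 * Real.pi * y) -
              ostrovskySymbol ε t (2 * Real.pi * ξ)‖ₑ ^ 2) * gagliardoWeight s y)) := by
          refine lintegral_mono fun y => ?_
          rw [← mul_assoc, ← mul_assoc, ← add_mul]
          gcongr
          exact lintegral_fourier_ostrovskyGroup_sub_le ε t f y
      _ = 2 * (P * K * Nf) + 2 * ∫⁻ y, (∫⁻ ξ, ‖(𝓕 f : L2R) ξ‖ₑ ^ 2 *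
            ‖ostrovskySymbol ε t (2 * Real.pi * ξ - 2 * Real.pi * y) -
              ostrovskySymbol ε t (2 * Real.pi * ξ)‖ₑ ^ 2) * gagliardoWeight s y := by
          have hm1 : Measurable fun y => ∫⁻ ξ, ‖(𝓕 f : L2R) (ξ - y) - (𝓕 f : L2R) ξ‖ₑ ^ 2 :=
            Measurable.lintegral_prod_right' (f := fun p : ℝ × ℝ =>
              ‖(𝓕 f : L2R) (p.2 - p.1) - (𝓕 f : L2R) p.2‖ₑ ^ 2) (by fun_prop)
          have hm2 : Measurable fun y => ∫⁻ ξ, ‖(𝓕 f : L2R) ξ‖ₑ ^ 2 *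
              ‖ostrovskySymbol ε t (2 * Real.pi * ξ - 2 * Real.pi * y) -
                ostrovskySymbol ε t (2 * Real.pi * ξ)‖ₑ ^ 2 :=
            Measurable.lintegral_prod_right' (f := fun p : ℝ × ℝ => ‖(𝓕 f : L2R) p.2‖ₑ ^ 2 *
              ‖ostrovskySymbol ε t (2 * Real.pi * p.2 - 2 * Real.pi * p.1) -
                ostrovskySymbol ε t (2 * Real.pi * p.2)‖ₑ ^ 2) (by fun_prop)
          rw [lintegral_add_left (by fun_prop), lintegral_const_mul _ (by fun_prop),
            lintegral_const_mul _ (by fun_prop), lintegral_gagliardo_fourier hs f]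
      _ ≤ 2 * (P * K * Nf) + 2 * (P * (C * A)) := by gcongr
      _ = P * K * (2 * Nf) + (K * K⁻¹) * (2 * (P * (C * A))) := by
          rw [ENNReal.mul_inv_cancel hK0 hK1]
          ring
      _ = _ := by ring
  -- Only `P` and `K` must be finite and nonzero; the weighted norm of the solution is not yet known
  -- to be finite.
  exact (ENNReal.mul_le_mul_iff_right (mul_ne_zero hP0 hK0) (ENNReal.mul_ne_top hP1 hK1)).mp key

/-! ### From squared integrals to the stated norms. -/

theorem sq_eLpNorm_rpow_abs_mul (b : ℝ) (f : L2R) :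
    eLpNorm (fun x : ℝ => ((|x| ^ b : ℝ) : ℂ) * f x) 2 volume ^ 2 =
      ∫⁻ x, ENNReal.ofReal (|x| ^ (2 * b)) * ‖f x‖ₑ ^ 2 := by
  rw [eLpNorm_eq_lintegral_rpow_enorm_toReal (by norm_num) (by norm_num),
    ← ENNReal.rpow_natCast, ← ENNReal.rpow_mul]
  norm_num
  refine lintegral_congr fun x => ?_
  rw [mul_pow, sq_enorm_eq_ofReal, Complex.norm_real, Real.norm_of_nonneg (by positivity),
    ← Real.rpow_mul_natCast (abs_nonneg _), mul_comm b]
  rfl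

theorem rpow_le_add_rpow {t b : ℝ} (ht : 0 ≤ t) (hb : 0 < b) (hb' : b ≤ 1 / 2) :
    t ^ b ≤ t ^ (1 / 3 + 2 * b / 3) + t ^ (2 * b / 3) := by
  have h1 : 0 ≤ t ^ (1 / 3 + 2 * b / 3) := by positivity
  have h2 : 0 ≤ t ^ (2 * b / 3) := by positivity
  rcases le_total 1 t with h | h
  · have := Real.rpow_le_rpow_of_exponent_le h (show b ≤ 1 / 3 + 2 * b / 3 by linarith)
    linarith
  · have := Real.rpow_le_rpow_of_exponent_ge' ht h (by positivity) (show 2 * b / 3 ≤ b by linarith)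
    linarith

theorem lemma2p4 (b : ℝ) (hb : 0 < b) (hb' : b ≤ 1 / 2) :
    ∃ C : ℝ, 0 < C ∧
      ∀ ε : ℝ, (ε = 1 ∨ ε = -1) → ∀ t : ℝ, 0 ≤ t → ∀ f : L2R, f ∈ ZSpace (2 * b) b →
        MemLp (fun x : ℝ => ((|x| ^ b : ℝ) : ℂ) * ostrovskyGroup ε t f x) 2 volume ∧
        lpNorm (fun x : ℝ => ((|x| ^ b : ℝ) : ℂ) * ostrovskyGroup ε t f x) 2 volume ≤
          C * ((1 + t ^ (b / 3) + t ^ (1 / 3 + 2 * b / 9)) * ‖f‖ +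
            (t ^ (1 / 3 + 2 * b / 3) + t ^ (2 * b / 3)) * ‖fracDeriv (2 * b) f‖ +
            t ^ b * ‖fracDeriv (-(2 * b)) f‖ +
            lpNorm (fun x : ℝ => ((|x| ^ b : ℝ) : ℂ) * f x) 2 volume) := by
  obtain ⟨C, hC, hest⟩ :=
    exists_lintegral_ostrovskyGroup_le (s := 2 * b) (by linarith) (by linarith)
  refine ⟨2 + C.toReal, by positivity, fun ε hε t ht f hf => ?_⟩
  obtain ⟨hf1, hf2, hf3⟩ := hf
  have h := hest ε (by rcases hε with rfl | rfl <;> norm_num) t ht f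
    (hasFracDeriv_of_memSobolev (by linarith) hf1) hf2
  rw [← sq_eLpNorm_rpow_abs_mul, ← sq_eLpNorm_rpow_abs_mul, ← ofReal_lpNorm hf3,
    ← ofReal_norm, ← ofReal_norm, ← ofReal_norm, ← ENNReal.ofReal_toReal hC.ne] at h
  have hsq : ∀ x : ℝ, 0 ≤ x → ∀ p : ℝ, x ^ p = (x ^ (p / 2)) ^ 2 := by
    intro x hx p
    rw [← Real.rpow_natCast, ← Real.rpow_mul hx]
    norm_num
  rw [hsq t ht (2 * b / 3), hsq t ht (2 * b), show 2 * b / 3 / 2 = b / 3 by ring,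
    show 2 * b / 2 = b by ring] at h
  set n := lpNorm (fun x : ℝ => ((|x| ^ b : ℝ) : ℂ) * f x) 2 volume
  set c := C.toReal
  set d := ‖fracDeriv (2 * b) f‖
  set e := ‖fracDeriv (-(2 * b)) f‖
  have hc : 0 ≤ c := ENNReal.toReal_nonneg
  have hn : 0 ≤ n := lpNorm_nonneg
  have hreal : ENNReal.ofReal (2 * n ^ 2 + c * ((t ^ (b / 3)) ^ 2 * ‖f‖ ^ 2 +
      (t ^ b) ^ 2 * d ^ 2 + (t ^ b) ^ 2 * e ^ 2)) =
      2 * ENNReal.ofReal n ^ 2 + ENNReal.ofReal c * (ENNReal.ofReal ((t ^ (b / 3)) ^ 2) *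
        ENNReal.ofReal ‖f‖ ^ 2 + ENNReal.ofReal ((t ^ b) ^ 2) * ENNReal.ofReal d ^ 2 +
        ENNReal.ofReal ((t ^ b) ^ 2) * ENNReal.ofReal e ^ 2) := by
    rw [ENNReal.ofReal_add (by positivity) (by positivity), ENNReal.ofReal_mul (by positivity),
      ENNReal.ofReal_mul (by positivity), ENNReal.ofReal_add (by positivity) (by positivity),
      ENNReal.ofReal_add (by positivity) (by positivity), ENNReal.ofReal_mul (by positivity),
      ENNReal.ofReal_mul (by positivity), ENNReal.ofReal_mul (by positivity),
      ENNReal.ofReal_pow hn, ENNReal.ofReal_pow (norm_nonneg f),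
      ENNReal.ofReal_pow (norm_nonneg (fracDeriv (2 * b) f)),
      ENNReal.ofReal_pow (norm_nonneg (fracDeriv (-(2 * b)) f)),
      ENNReal.ofReal_ofNat]
  rw [← hreal] at h
  have hmeas : AEStronglyMeasurable
      (fun x : ℝ => ((|x| ^ b : ℝ) : ℂ) * ostrovskyGroup ε t f x) volume :=
    (Measurable.aestronglyMeasurable (by fun_prop)).mul (Lp.aestronglyMeasurable _)
  have hmem : MemLp (fun x : ℝ => ((|x| ^ b : ℝ) : ℂ) * ostrovskyGroup ε t f x) 2 volume := by
    -- The right side of `h` is finite, so the estimate itself proves membership in `L²`.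
    refine ⟨hmeas, lt_top_iff_ne_top.mpr fun htop => ?_⟩
    rw [htop] at h
    simp at h
  refine ⟨hmem, ?_⟩
  rw [← ofReal_lpNorm hmem, ← ENNReal.ofReal_pow lpNorm_nonneg,
    ENNReal.ofReal_le_ofReal_iff (by positivity)] at h
  have hd : 0 ≤ d := norm_nonneg _
  have he : 0 ≤ e := norm_nonneg _
  -- The sharper bound, before the time factors are enlarged; `2 + c` absorbs both constants, as `2
  -- + c ≤ (2 + c)²`.
  have h1 : lpNorm (fun x : ℝ => ((|x| ^ b : ℝ) : ℂ) * ostrovskyGroup ε t f x) 2 volume ≤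
      (2 + c) * (t ^ (b / 3) * ‖f‖ + t ^ b * d + t ^ b * e + n) := by
    refine le_of_sq_le_sq (h.trans ?_) (by positivity)
    have hsum : ∀ p q r m : ℝ, 0 ≤ p → 0 ≤ q → 0 ≤ r → 0 ≤ m →
        2 * m ^ 2 + c * (p ^ 2 + q ^ 2 + r ^ 2) ≤ ((2 + c) * (p + q + r + m)) ^ 2 := by
      intro p q r m hp hq hr hm
      have hS : p ^ 2 + q ^ 2 + r ^ 2 + m ^ 2 ≤ (p + q + r + m) ^ 2 := by
        have : 0 ≤ p * q + p * r + p * m + q * r + q * m + r * m := by positivity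
        nlinarith
      calc 2 * m ^ 2 + c * (p ^ 2 + q ^ 2 + r ^ 2)
          ≤ (2 + c) * (p ^ 2 + q ^ 2 + r ^ 2 + m ^ 2) := by
            have : 0 ≤ 2 * (p ^ 2 + q ^ 2 + r ^ 2) + c * m ^ 2 := by positivity
            linarith
        _ ≤ (2 + c) ^ 2 * (p + q + r + m) ^ 2 := by
            gcongr
            nlinarith
        _ = _ := by ring
    have := hsum (t ^ (b / 3) * ‖f‖) (t ^ b * d) (t ^ b * e) n (by positivity) (by positivity)
      (by positivity) hn
    simpa only [mul_pow] using this
  refine h1.trans ?_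
  have ht3 : t ^ (b / 3) ≤ 1 + t ^ (b / 3) + t ^ (1 / 3 + 2 * b / 9) := by
    have : 0 ≤ t ^ (1 / 3 + 2 * b / 9) := by positivity
    linarith
  gcongr
  exact rpow_le_add_rpow ht hb hb'
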